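/- For $n\in\{0,1,2,\dots\}\cup\{\infty\}$ let $\mathbb F_n$ be the free group on $n$ (countably many if $n=\infty$) free generators $(g_i)_i$, let $|g|$ be the reduced word length, and for a family $a=(a_i)_i$ of positive real numbers let $$|g|_a=\sum_{j=1}^m a_{i_j}|k_j|\qquad\text{for } g=g_{i_1}^{k_1}\cdots g_{i_m}^{k_m},\ i_j\neq i_{j+1},\ k_j\in\mathbb Z\setminus\{0\},$$ so that $|\cdot|=|\cdot|_a$ when $a_i=1$ for all $i$. For a discrete group $\Gamma$ with left regular representation $\lambda$ on $\ell^2(\Gamma)$ and $\psi:\Gamma\to\mathbb C$, let $\|\lambda_g\mapsto\psi(g)\lambda_g\|_{cb}\in[0,\infty]$ be the completely bounded norm of the Fourier multiplier $\sum_g\hat x(g)\lambda_g\mapsto\sum_g\psi(g)\hat x(g)\lambda_g$ on the group von Neumann algebra $\mathcal L(\Gamma)$ (equal to $\infty$ if this does not define a completely bounded map on $\mathcal L(\Gamma)$). **Proposition 2.5.** Let $\varphi:[0,\infty)\to\mathbb C$ be continuous and let $C\ge 0$. Suppose that, on $\mathbb F_\infty$, $$\|\lambda_g\mapsto\varphi(t|g|)\lambda_g\|_{cb}\le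 C\qquad\text{for all } 0<t<1.$$ Then for every $n\in\{0,1,2,\dots\}\cup\{\infty\}$, every family $a$ of positive weights on the generators of $\mathbb F_n$ and every $t>0$, on $\mathbb F_n$, $$\|\lambda_g\mapsto\varphi(t|g|_a)\lambda_g\|_{cb}\le C .$$ -/

import Mathlib

open scoped ENNReal NNReal

noncomputable section

/-! ### The group von Neumann algebra -/

/-- The Hilbert space `ℓ²(Γ)` of square summable complex functions on `Γ`. -/
abbrev GroupL2 (Γ : Type*) : Type _ := lp (fun _ : Γ => ℂ) 2

section Regular

variable {Γ : Type*} [Group Γ]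

theorem memlp_leftTranslate (g : Γ) (f : GroupL2 Γ) :
    Memℓp (fun h : Γ => f (g⁻¹ * h)) 2 := by
  have h2 : 0 < (2 : ℝ≥0∞).toReal := by norm_num
  rw [memℓp_gen_iff h2]
  exact (Equiv.mulLeft g⁻¹).summable_iff.mpr ((lp.memℓp f).summable h2)

/-- The left regular representation `(λ_g f)(h) = f (g⁻¹ h)`, as an isometry of `ℓ²(Γ)`. -/
def leftRegularIsometry (g : Γ) : GroupL2 Γ →ₗᵢ[ℂ] GroupL2 Γ where
  toFun f := ⟨fun h => f (g⁻¹ * h), memlp_leftTranslate g f⟩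
  map_add' _ _ := rfl
  map_smul' _ _ := rfl
  norm_map' f := by
    have h2 : 0 < (2 : ℝ≥0∞).toReal := by norm_num
    change ‖(⟨fun h => f (g⁻¹ * h), memlp_leftTranslate g f⟩ : GroupL2 Γ)‖ = ‖f‖
    rw [lp.norm_eq_tsum_rpow h2, lp.norm_eq_tsum_rpow h2]
    congr 1
    exact (Equiv.mulLeft g⁻¹).tsum_eq fun h => ‖f h‖ ^ (2 : ℝ≥0∞).toReal

/-- The operator `λ_g` on `ℓ²(Γ)`. -/
def leftRegular (g : Γ) : GroupL2 Γ →L[ℂ] GroupL2 Γ :=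
  (leftRegularIsometry g).toContinuousLinearMap

/-- The unit vector `δ_g` of `ℓ²(Γ)`. -/
def deltaVec (g : Γ) : GroupL2 Γ :=
  open Classical in lp.single 2 g (1 : ℂ)

end Regular

/-- The group von Neumann algebra `𝓛(Γ)`: the double commutant of `{λ_g : g ∈ Γ}` in `B(ℓ²(Γ))`.
(`StarSubalgebra.centralizer` is the commutant of a set and its adjoints; here the set is
already closed under adjoints because `λ_g⋆ = λ_{g⁻¹}`.) -/
def groupVN (Γ : Type*) [Group Γ] : VonNeumannAlgebra (GroupL2 Γ) where
  toStarSubalgebra := StarSubalgebra.centralizer ℂ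
    (StarSubalgebra.centralizer ℂ (Set.range (leftRegular (Γ := Γ))) :
      Set (GroupL2 Γ →L[ℂ] GroupL2 Γ))
  centralizer_centralizer' := by
    change Set.centralizer (Set.centralizer (StarSubalgebra.centralizer ℂ
      (StarSubalgebra.centralizer ℂ (Set.range (leftRegular (Γ := Γ))) :
        Set (GroupL2 Γ →L[ℂ] GroupL2 Γ)) : Set (GroupL2 Γ →L[ℂ] GroupL2 Γ))) =
      (StarSubalgebra.centralizer ℂ
      (StarSubalgebra.centralizer ℂ (Set.range (leftRegular (Γ := Γ))) :
        Set (GroupL2 Γ →L[ℂ] GroupL2 Γ)) : Set (GroupL2 Γ →L[ℂ] GroupL2 Γ))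
    rw [StarSubalgebra.coe_centralizer_centralizer, Set.centralizer_centralizer_centralizer]

/-! ### Completely bounded norms -/

section CB

variable {H : Type*} [NormedAddCommGroup H] [InnerProductSpace ℂ H]

/-- The operator on the Hilbert space direct sum `Hⁿ` given by an `n × n` matrix of operators
on `H`. -/
def matrixOp {n : ℕ} (x : Matrix (Fin n) (Fin n) (H →L[ℂ] H)) :
    PiLp 2 (fun _ : Fin n => H) →L[ℂ] PiLp 2 (fun _ : Fin n => H) :=
  ((PiLp.continuousLinearEquiv 2 ℂ (fun _ : Fin n => H)).symm : _ →L[ℂ] _) ∘L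
    (ContinuousLinearMap.pi fun i =>
      ∑ j, x i j ∘L (ContinuousLinearMap.proj j : (Fin n → H) →L[ℂ] H)) ∘L
    ((PiLp.continuousLinearEquiv 2 ℂ (fun _ : Fin n => H)) : _ →L[ℂ] _)

variable [CompleteSpace H]

instance VonNeumannAlgebra.instSMulMemClassComplex :
    SMulMemClass (VonNeumannAlgebra H) ℂ (H →L[ℂ] H) where
  smul_mem {S} c _ hx := S.toStarSubalgebra.smul_mem hx c

/-- The completely bounded norm (possibly `∞`) of a linear map `T` of a von Neumann algebra
`M ⊆ B(H)` to itself: the supremum over `n` of the norms of the maps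
`[x i j] ↦ [T (x i j)]` on `Mₙ(M) ⊆ B(Hⁿ)`. -/
def cbNorm {M : VonNeumannAlgebra H} (T : M →ₗ[ℂ] M) : ℝ≥0∞ :=
  ⨆ (n : ℕ) (x : Matrix (Fin n) (Fin n) M)
    (_ : ‖matrixOp (x.map fun y => (y : H →L[ℂ] H))‖ ≤ 1),
    ‖matrixOp (x.map fun y => (T y : H →L[ℂ] H))‖ₑ

end CB

/-! ### Fourier multipliers -/

section Multiplier

variable {Γ : Type*} [Group Γ]

/-- The Fourier coefficient `⟨δ_g, x δ_e⟩` of `x ∈ 𝓛(Γ)`, so that `x = ∑ g, x̂(g) λ_g`. -/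
def groupFourierCoeff (x : groupVN Γ) (g : Γ) : ℂ :=
  inner ℂ (deltaVec g) ((x : GroupL2 Γ →L[ℂ] GroupL2 Γ) (deltaVec 1))

/-- `T` is the Fourier multiplier `λ_g ↦ ψ(g) λ_g` on `𝓛(Γ)`, that is
`∑ g, x̂(g) λ_g ↦ ∑ g, ψ(g) x̂(g) λ_g` for every `x ∈ 𝓛(Γ)`. -/
def IsFourierMultiplier (ψ : Γ → ℂ) (T : groupVN Γ →ₗ[ℂ] groupVN Γ) : Prop :=
  ∀ (x : groupVN Γ) (g : Γ), groupFourierCoeff (T x) g = ψ g * groupFourierCoeff x g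

/-- The completely bounded norm of the Fourier multiplier `λ_g ↦ ψ(g) λ_g` on `𝓛(Γ)`. There is at
most one `T` with `IsFourierMultiplier ψ T`, because an element of `𝓛(Γ)` is determined by its
Fourier coefficients; the value is `∞` if the multiplier is not everywhere defined on `𝓛(Γ)`, or is
not completely bounded. -/
def multiplierCBNorm (ψ : Γ → ℂ) : ℝ≥0∞ :=
  ⨅ (T : groupVN Γ →ₗ[ℂ] groupVN Γ) (_ : IsFourierMultiplier ψ T), cbNorm T

end Multiplier

/-- The weighted length `|g|_a` on a free group: if `g = g_{i₁}^{k₁} ⋯ g_{i_m}^{k_m}` is reduced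
(`i_j ≠ i_{j+1}`, `k_j ≠ 0`), then `|g|_a = ∑ a_{i_j} |k_j|`, that is the sum of the weights of all
letters `g_i^{±1}` of the reduced word of `g`, each counted with multiplicity. -/
def weightedLength {ι : Type*} [DecidableEq ι] (a : ι → ℝ) (g : FreeGroup ι) : ℝ :=
  (g.toWord.map fun p => a p.1).sum

end

/-! ### Square summable functions -/

section L2

variable {Γ : Type*}

/-! Embed the generators of `FreeGroup ι` into those of `FreeGroup ℕ` by an injection `e` and send
`g_i` to `g_{e i} ^ N i` with `N i ≥ 1`. Reduced words stay reduced, so the word length pulls back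
to the length with integer weights `N` (`norm_lift_pow`). With `N i = ⌈t a_i / s⌉` and `s → 0+`, the
numbers `s N i` tend to `t a_i`, so by continuity `φ(t|g|_a)` is a pointwise limit of pullbacks of
`φ(s|·|)`. Only small `s` matter, hence bounds for `0 < s < 1` suffice.

It remains that a cb-norm bound survives pullback along homomorphisms and pointwise limits. Both are
immediate for `IsSchurBounded`, which tests finitely many values of `ψ` at a time. Its equivalence
with the cb bound is `isSchurBounded_of_multiplierCBNorm_le` and
`IsSchurBounded.multiplierCBNorm_le`: scalar matrices are twisted by the unitaries `λ_{s_i}` in one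
direction, and operators are cut to finite sections in the other. -/

theorem GroupL2.hasSum_norm_sq (f : GroupL2 Γ) : HasSum (fun g => ‖f g‖ ^ 2) (‖f‖ ^ 2) := by
  simpa using lp.hasSum_norm (by norm_num : 0 < (2 : ℝ≥0∞).toReal) f

theorem GroupL2.sum_norm_sq_le (f : GroupL2 Γ) (F : Finset Γ) :
    ∑ g ∈ F, ‖f g‖ ^ 2 ≤ ‖f‖ ^ 2 :=
  sum_le_hasSum F (fun _ _ => by positivity) f.hasSum_norm_sq

open Classical in
theorem deltaVec_apply [Group Γ] (g h : Γ) : deltaVec g h = if h = g then (1 : ℂ) else 0 := by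
  rw [deltaVec, lp.single_apply, Pi.single_apply]

theorem inner_deltaVec [Group Γ] (g : Γ) (f : GroupL2 Γ) : inner ℂ (deltaVec g) f = f g := by
  classical
  rw [deltaVec, lp.inner_single_left]
  simp

theorem hasSum_smul_deltaVec [Group Γ] (f : GroupL2 Γ) :
    HasSum (fun g => f g • deltaVec g) f := by
  classical
  have h := lp.hasSum_single (p := 2) (by norm_num) f
  convert h using 2 with g
  rw [deltaVec, ← lp.single_smul]
  simp

/-- Evaluating an operator through its matrix coefficients. -/
theorem hasSum_apply_deltaVec [Group Γ] (x : GroupL2 Γ →L[ℂ] GroupL2 Γ) (f : GroupL2 Γ) (k : Γ) :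
    HasSum (fun h => f h * x (deltaVec h) k) (x f k) := by
  have h := ((lp.evalCLM ℂ (fun _ : Γ => ℂ) 2 k).comp x).hasSum (hasSum_smul_deltaVec f)
  simp only [ContinuousLinearMap.comp_apply, map_smul, smul_eq_mul] at h
  exact h

theorem ext_deltaVec [Group Γ] {x y : GroupL2 Γ →L[ℂ] GroupL2 Γ}
    (h : ∀ g k, x (deltaVec g) k = y (deltaVec g) k) : x = y := by
  ext f k
  have hx := hasSum_apply_deltaVec x f k
  simp only [h] at hx
  exact hx.unique (hasSum_apply_deltaVec y f k)

/-- An infinite matrix whose finite sections are bounded by `K` defines an operator on `ℓ²`. -/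
theorem exists_operator_of_finite_sections [Group Γ] (A : Γ → Γ → ℂ) (K : ℝ)
    (hA : ∀ (F : Finset Γ) (f : Γ → ℂ),
      ∑ k ∈ F, ‖∑ h ∈ F, A k h * f h‖ ^ 2 ≤ K * ∑ h ∈ F, ‖f h‖ ^ 2) :
    ∃ x : GroupL2 Γ →L[ℂ] GroupL2 Γ, ∀ h k, x (deltaVec h) k = A k h := by
  classical
  have hK (F : Finset Γ) (f : GroupL2 Γ) :
      ∑ k ∈ F, ‖∑ h ∈ F, A k h * f h‖ ^ 2 ≤ |K| * ‖f‖ ^ 2 := by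
    refine (hA F f).trans ?_
    have h1 := f.sum_norm_sq_le F
    have h0 : 0 ≤ ∑ h ∈ F, ‖f h‖ ^ 2 := by positivity
    calc _ ≤ |K| * ∑ h ∈ F, ‖f h‖ ^ 2 := mul_le_mul_of_nonneg_right (le_abs_self K) h0
      _ ≤ _ := mul_le_mul_of_nonneg_left h1 (abs_nonneg K)
  have hrow (k : Γ) : Summable fun h => ‖A k h‖ ^ 2 := by
    refine summable_of_sum_le (c := |K|) (fun _ => by positivity) fun F => ?_
    set S := ∑ h ∈ F, ‖A k h‖ ^ 2 with hS
    have hS0 : 0 ≤ S := by positivity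
    set G := insert k F with hG
    -- Testing on the conjugate of row `k` cut to `F` gives `S ^ 2 ≤ K * S`; `k` is added to `F` so
    -- that the section sees this row.
    have h1 := hA G (fun h => if h ∈ F then (starRingEnd ℂ) (A k h) else 0)
    have hcol (j : Γ) : ∑ h ∈ G, A j h * (if h ∈ F then (starRingEnd ℂ) (A k h) else 0) =
        ∑ h ∈ F, A j h * (starRingEnd ℂ) (A k h) := by
      simp only [mul_ite, mul_zero]
      rw [← Finset.sum_filter]
      congr 1
      ext h; simp [hG]
    have hnorm : ∑ h ∈ G, ‖(if h ∈ F then (starRingEnd ℂ) (A k h) else 0)‖ ^ 2 = S := by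
      rw [hS]
      have : ∀ h, ‖(if h ∈ F then (starRingEnd ℂ) (A k h) else 0)‖ ^ 2 =
          if h ∈ F then ‖A k h‖ ^ 2 else 0 := by
        intro h; split_ifs <;> simp
      simp only [this]
      rw [← Finset.sum_filter]
      congr 1
      ext h; simp [hG]
    rw [hnorm] at h1
    simp only [hcol] at h1
    have h2 := (Finset.single_le_sum (f := fun j =>
      ‖∑ h ∈ F, A j h * (starRingEnd ℂ) (A k h)‖ ^ 2) (fun _ _ => by positivity)
      (Finset.mem_insert_self k F)).trans h1
    have h3 : ∑ h ∈ F, A k h * (starRingEnd ℂ) (A k h) = (S : ℂ) := by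
      simp [hS, Complex.mul_conj, Complex.normSq_eq_norm_sq]
    simp only [h3, Complex.norm_real, Real.norm_eq_abs, sq_abs] at h2
    rcases hS0.eq_or_lt with h | h
    · rw [← h]; positivity
    · have : S ≤ K := by nlinarith
      exact this.trans (le_abs_self K)
  have hsum (f : GroupL2 Γ) (k : Γ) : Summable fun h => A k h * f h := by
    refine Summable.of_norm_bounded ((hrow k).add f.hasSum_norm_sq.summable) fun h => ?_
    rw [norm_mul]
    nlinarith [sq_nonneg (‖A k h‖ - ‖f h‖), sq_nonneg (‖A k h‖), sq_nonneg ‖f h‖]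
  have hbound (f : GroupL2 Γ) (F : Finset Γ) :
      ∑ k ∈ F, ‖∑' h, A k h * f h‖ ^ 2 ≤ |K| * ‖f‖ ^ 2 := by
    -- The rows stay in `F` while the columns exhaust `Γ`; once `G ⊇ F`, the section bound on `G`
    -- applies.
    have hlim : Filter.Tendsto (fun G : Finset Γ => ∑ k ∈ F, ‖∑ h ∈ G, A k h * f h‖ ^ 2)
        Filter.atTop (nhds (∑ k ∈ F, ‖∑' h, A k h * f h‖ ^ 2)) :=
      tendsto_finsetSum _ fun k _ => ((hsum f k).hasSum.norm).pow 2
    refine le_of_tendsto hlim ?_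
    filter_upwards [Filter.eventually_ge_atTop F] with G hG
    exact (Finset.sum_le_sum_of_subset_of_nonneg hG fun _ _ _ => by positivity).trans (hK G f)
  have h2 : (0 : ℝ) < (2 : ℝ≥0∞).toReal := by norm_num
  have hmem (f : GroupL2 Γ) : Memℓp (fun k => ∑' h, A k h * f h) 2 := by
    rw [memℓp_gen_iff h2]
    refine summable_of_sum_le (c := |K| * ‖f‖ ^ 2) (fun _ => by positivity) fun F => ?_
    simpa using hbound f F
  let L : GroupL2 Γ →ₗ[ℂ] GroupL2 Γ :=
    { toFun := fun f => ⟨fun k => ∑' h, A k h * f h, hmem f⟩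
      map_add' := fun f g => by
        ext k
        change ∑' h, A k h * (f h + g h) = ∑' h, A k h * f h + ∑' h, A k h * g h
        rw [← (hsum f k).tsum_add (hsum g k)]
        simp only [mul_add]
      map_smul' := fun c f => by
        ext k
        change ∑' h, A k h * (c * f h) = c * ∑' h, A k h * f h
        rw [← tsum_mul_left]
        simp only [mul_left_comm] }
  have hL (f : GroupL2 Γ) (k : Γ) : L f k = ∑' h, A k h * f h := rfl
  refine ⟨L.mkContinuous (√|K|) fun f => ?_, fun h k => ?_⟩
  · have h3 : ‖L f‖ ^ 2 ≤ |K| * ‖f‖ ^ 2 :=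
      hasSum_le_of_sum_le (L f).hasSum_norm_sq fun F => hbound f F
    have h4 : |K| * ‖f‖ ^ 2 = (√|K| * ‖f‖) ^ 2 := by
      rw [mul_pow, Real.sq_sqrt (abs_nonneg K)]
    rw [h4] at h3
    exact le_of_sq_le_sq h3 (by positivity)
  · rw [LinearMap.mkContinuous_apply, hL, tsum_eq_single h]
    · simp [deltaVec_apply]
    · intro j hj
      simp [deltaVec_apply, hj]

end L2

/-! ### Matrix coefficients of the group von Neumann algebra and of its commutant -/

section VN

variable {Γ : Type*} [Group Γ]

theorem leftRegular_apply (g h : Γ) (f : GroupL2 Γ) : leftRegular g f h = f (g⁻¹ * h) := rfl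

theorem leftRegular_deltaVec (g h : Γ) : leftRegular g (deltaVec h) = deltaVec (g * h) := by
  ext k
  rw [leftRegular_apply, deltaVec_apply, deltaVec_apply]
  congr 1
  exact propext inv_mul_eq_iff_eq_mul

theorem leftRegular_mul (g h : Γ) : leftRegular (g * h) = leftRegular g * leftRegular h := by
  ext f k
  simp [leftRegular_apply, mul_assoc]

theorem leftRegular_one : leftRegular (1 : Γ) = 1 := by
  ext f k
  simp [leftRegular_apply]

theorem norm_leftRegular_apply (g : Γ) (f : GroupL2 Γ) : ‖leftRegular g f‖ = ‖f‖ :=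
  (leftRegularIsometry g).norm_map f

theorem inner_leftRegular (g : Γ) (f f' : GroupL2 Γ) :
    inner ℂ (leftRegular g f) f' = inner ℂ f (leftRegular g⁻¹ f') := by
  have h : f' = leftRegular g (leftRegular g⁻¹ f') := by
    rw [← mul_apply_eq_comp, ← leftRegular_mul, mul_inv_cancel, leftRegular_one]
    rfl
  conv_lhs => rw [h]
  exact (leftRegularIsometry g).inner_map_map _ _

theorem star_leftRegular (g : Γ) : star (leftRegular g) = leftRegular g⁻¹ := by
  rw [ContinuousLinearMap.star_eq_adjoint, eq_comm, ContinuousLinearMap.eq_adjoint_iff]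
  intro x y
  rw [inner_leftRegular, inv_inv]

/-- The commutant of the left regular representation. -/
noncomputable abbrev regularCommutant (Γ : Type*) [Group Γ] : StarSubalgebra ℂ (GroupL2 Γ →L[ℂ] GroupL2 Γ) :=
  StarSubalgebra.centralizer ℂ (Set.range (leftRegular (Γ := Γ)))

theorem mem_regularCommutant {z : GroupL2 Γ →L[ℂ] GroupL2 Γ} :
    z ∈ regularCommutant Γ ↔ ∀ g, leftRegular g * z = z * leftRegular g := by
  rw [StarSubalgebra.mem_centralizer_iff]
  simp only [Set.forall_mem_range, star_leftRegular]
  exact ⟨fun h g => (h g).1, fun h g => ⟨h g, h g⁻¹⟩⟩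

theorem mem_groupVN {x : GroupL2 Γ →L[ℂ] GroupL2 Γ} :
    x ∈ groupVN Γ ↔ ∀ z ∈ regularCommutant Γ, z * x = x * z := by
  change x ∈ StarSubalgebra.centralizer ℂ (regularCommutant Γ : Set _) ↔ _
  rw [StarSubalgebra.mem_centralizer_iff]
  exact ⟨fun h z hz => (h z hz).1, fun h z hz => ⟨h z hz, h _ (star_mem hz)⟩⟩

theorem leftRegular_mem_groupVN (g : Γ) : leftRegular g ∈ groupVN Γ :=
  mem_groupVN.2 fun _ hz => (mem_regularCommutant.1 hz g).symm

theorem regularCommutant_coeff {z : GroupL2 Γ →L[ℂ] GroupL2 Γ} (hz : z ∈ regularCommutant Γ)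
    (g h k : Γ) : z (deltaVec (g * h)) (g * k) = z (deltaVec h) k := by
  have h1 := DFunLike.congr_fun (mem_regularCommutant.1 hz g) (deltaVec h)
  simp only [mul_apply_eq_comp, leftRegular_deltaVec] at h1
  rw [← h1, leftRegular_apply, inv_mul_cancel_left]

/-- The right translation `(ρ_g f)(h) = f (h g)`. -/
theorem exists_rightTranslate (g : Γ) : ∃ z ∈ regularCommutant Γ,
    ∀ (f : GroupL2 Γ) (h : Γ), z f h = f (h * g) := by
  have h2 : 0 < (2 : ℝ≥0∞).toReal := by norm_num
  have hm (f : GroupL2 Γ) : Memℓp (fun h : Γ => f (h * g)) 2 := by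
    rw [memℓp_gen_iff h2]
    exact (Equiv.mulRight g).summable_iff.mpr ((lp.memℓp f).summable h2)
  let z : GroupL2 Γ →ₗᵢ[ℂ] GroupL2 Γ :=
    { toFun := fun f => ⟨fun h => f (h * g), hm f⟩
      map_add' := fun _ _ => rfl
      map_smul' := fun _ _ => rfl
      norm_map' := fun f => by
        change ‖(⟨fun h => f (h * g), hm f⟩ : GroupL2 Γ)‖ = ‖f‖
        rw [lp.norm_eq_tsum_rpow h2, lp.norm_eq_tsum_rpow h2]
        congr 1
        exact (Equiv.mulRight g).tsum_eq fun h => ‖f h‖ ^ (2 : ℝ≥0∞).toReal }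
  refine ⟨z.toContinuousLinearMap, mem_regularCommutant.2 fun k => ?_, fun _ _ => rfl⟩
  ext f h
  change f (k⁻¹ * h * g) = f (k⁻¹ * (h * g))
  rw [mul_assoc]

theorem groupFourierCoeff_eq (x : groupVN Γ) (g : Γ) :
    groupFourierCoeff x g = (x : GroupL2 Γ →L[ℂ] GroupL2 Γ) (deltaVec 1) g :=
  inner_deltaVec _ _

/-- Right translations lie in the commutant and move `δ_1` to `δ_h`, so column `h` of `x` is a
translate of column `1`. -/
theorem groupVN_coeff (x : groupVN Γ) (h k : Γ) :
    (x : GroupL2 Γ →L[ℂ] GroupL2 Γ) (deltaVec h) k = groupFourierCoeff x (k * h⁻¹) := by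
  obtain ⟨z, hz, hzf⟩ := exists_rightTranslate h⁻¹
  have h1 : z (deltaVec 1) = deltaVec h := by
    ext k
    rw [hzf, deltaVec_apply, deltaVec_apply]
    congr 1
    exact propext mul_inv_eq_one
  have h2 := DFunLike.congr_fun (mem_groupVN.1 x.2 z hz) (deltaVec 1)
  simp only [mul_apply_eq_comp, h1] at h2
  rw [← h2, hzf, groupFourierCoeff_eq]

theorem groupVN_ext {x y : groupVN Γ} (h : ∀ g, groupFourierCoeff x g = groupFourierCoeff y g) :
    x = y :=
  Subtype.ext <| ext_deltaVec fun g k => by rw [groupVN_coeff, groupVN_coeff, h]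

/-- An operator whose matrix is constant along `k h⁻¹` lies in the group von Neumann algebra. -/
theorem mem_groupVN_of_coeff {x : GroupL2 Γ →L[ℂ] GroupL2 Γ} (c : Γ → ℂ)
    (hx : ∀ h k, x (deltaVec h) k = c (k * h⁻¹)) : x ∈ groupVN Γ := by
  refine mem_groupVN.2 fun z hz => ext_deltaVec fun h g => ?_
  have h1 := hasSum_apply_deltaVec z (x (deltaVec h)) g
  have h2 := hasSum_apply_deltaVec x (z (deltaVec h)) g
  -- The substitution `k ↦ h k⁻¹ g` matches the two matrix products term by term, since the matrix
  -- of `z` is invariant under left translation.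
  let e : Γ ≃ Γ := (Equiv.inv Γ).trans ((Equiv.mulLeft h).trans (Equiv.mulRight g))
  have he (k : Γ) : e k = h * k⁻¹ * g := rfl
  rw [← e.hasSum_iff] at h2
  have h3 : (fun k => x (deltaVec h) k * z (deltaVec k) g) =
      (fun k => z (deltaVec h) k * x (deltaVec k) g) ∘ e := by
    funext k
    have := regularCommutant_coeff hz (h * k⁻¹) k g
    rw [inv_mul_cancel_right] at this
    simp only [Function.comp, he, hx, this]
    rw [mul_comm]
    congr 2
    group
  rw [h3] at h1
  exact h1.unique h2

theorem groupFourierCoeff_add (x y : groupVN Γ) (g : Γ) :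
    groupFourierCoeff (x + y) g = groupFourierCoeff x g + groupFourierCoeff y g := by
  simp [groupFourierCoeff_eq]

theorem groupFourierCoeff_smul (c : ℂ) (x : groupVN Γ) (g : Γ) :
    groupFourierCoeff (c • x) g = c * groupFourierCoeff x g := by
  simp only [groupFourierCoeff_eq]
  rfl

open Classical in
theorem groupFourierCoeff_leftRegular (g h : Γ) :
    groupFourierCoeff ⟨leftRegular g, leftRegular_mem_groupVN g⟩ h = if h = g then 1 else 0 := by
  rw [groupFourierCoeff_eq]
  simp [leftRegular_deltaVec, deltaVec_apply]

end VN

/-! ### Fourier multipliers and Schur multipliers -/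

section Schur

theorem matrixOp_apply {H : Type*} [NormedAddCommGroup H] [InnerProductSpace ℂ H] {n : ℕ}
    (x : Matrix (Fin n) (Fin n) (H →L[ℂ] H)) (v : PiLp 2 (fun _ : Fin n => H)) (i : Fin n) :
    matrixOp x v i = ∑ j, x i j (v j) := by
  simp [matrixOp]

/-- Scalar matrices acting on vectors with entries in `ℓ²` have the same norm. -/
theorem sum_norm_sq_smul_le {Γ : Type*} {m : ℕ} {x : Fin m → Fin m → ℂ}
    (hx : ∀ c : Fin m → ℂ, ∑ i, ‖∑ j, x i j * c j‖ ^ 2 ≤ ∑ j, ‖c j‖ ^ 2)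
    (w : Fin m → GroupL2 Γ) : ∑ i, ‖∑ j, x i j • w j‖ ^ 2 ≤ ∑ j, ‖w j‖ ^ 2 := by
  refine hasSum_le (fun g => ?_) (hasSum_sum fun i _ => (∑ j, x i j • w j).hasSum_norm_sq)
    (hasSum_sum fun j _ => (w j).hasSum_norm_sq)
  have h := hx (fun j => w j g)
  refine le_trans (le_of_eq ?_) h
  refine Finset.sum_congr rfl fun i _ => ?_
  rw [lp.coeFn_sum, Finset.sum_apply]
  rfl

variable {Γ : Type*} [Group Γ]

/-- `ψ` defines a Schur multiplier `ψ(s⁻¹ t)` of norm at most `C`. Repetitions in `s` are allowed,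
which amounts to the completely bounded norm. -/
def IsSchurBounded (ψ : Γ → ℂ) (C : ℝ≥0) : Prop :=
  ∀ (m : ℕ) (s : Fin m → Γ) (x : Fin m → Fin m → ℂ),
    (∀ c : Fin m → ℂ, ∑ i, ‖∑ j, x i j * c j‖ ^ 2 ≤ ∑ j, ‖c j‖ ^ 2) →
    ∀ c : Fin m → ℂ, ∑ i, ‖∑ j, ψ ((s i)⁻¹ * s j) * x i j * c j‖ ^ 2 ≤ C ^ 2 * ∑ j, ‖c j‖ ^ 2

theorem IsSchurBounded.comp_monoidHom {Λ : Type*} [Group Λ] {ψ : Γ → ℂ} {C : ℝ≥0}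
    (h : IsSchurBounded ψ C) (π : Λ →* Γ) : IsSchurBounded (fun g => ψ (π g)) C := by
  intro m s x hx c
  simpa using h m (fun i => π (s i)) x hx c

/-- Each defining inequality is closed and involves only finitely many values of `ψ`. -/
theorem IsSchurBounded.of_tendsto {κ : Type*} {l : Filter κ} [l.NeBot] {ψ : κ → Γ → ℂ}
    {ψ' : Γ → ℂ} {C : ℝ≥0} (h : ∀ᶠ k in l, IsSchurBounded (ψ k) C)
    (hlim : ∀ g, Filter.Tendsto (fun k => ψ k g) l (nhds (ψ' g))) : IsSchurBounded ψ' C := by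
  intro m s x hx c
  refine le_of_tendsto (tendsto_finsetSum _ fun i _ => ((tendsto_finsetSum _ fun j _ =>
    ((hlim ((s i)⁻¹ * s j)).mul_const (x i j)).mul_const (c j)).norm).pow 2) ?_
  filter_upwards [h] with k hk
  exact hk m s x hx c

theorem IsSchurBounded.fintype {ψ : Γ → ℂ} {C : ℝ≥0} (h : IsSchurBounded ψ C)
    {α : Type*} [Fintype α] (s : α → Γ) (x : α → α → ℂ)
    (hx : ∀ c : α → ℂ, ∑ i, ‖∑ j, x i j * c j‖ ^ 2 ≤ ∑ j, ‖c j‖ ^ 2) (c : α → ℂ) :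
    ∑ i, ‖∑ j, ψ ((s i)⁻¹ * s j) * x i j * c j‖ ^ 2 ≤ C ^ 2 * ∑ j, ‖c j‖ ^ 2 := by
  let e := (Fintype.equivFin α).symm
  have h1 := h _ (fun i => s (e i)) (fun i j => x (e i) (e j)) (fun d => by
    have h2 := hx (fun a => d (e.symm a))
    rw [← e.sum_comp, ← e.sum_comp (fun a => ‖d (e.symm a)‖ ^ 2)] at h2
    simp only [← e.sum_comp (fun a => x _ a * d (e.symm a)), e.symm_apply_apply] at h2
    exact h2) (fun i => c (e i))
  rw [← e.sum_comp, ← e.sum_comp (fun a => ‖c a‖ ^ 2)]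
  simp only [← e.sum_comp (fun a => ψ (_ * s a) * x _ a * c a)]
  exact h1

/-- `λ_g` as an element of the group von Neumann algebra. -/
noncomputable def groupVN.of (g : Γ) : groupVN Γ := ⟨leftRegular g, leftRegular_mem_groupVN g⟩

theorem IsFourierMultiplier.map_smul_of {ψ : Γ → ℂ} {T : groupVN Γ →ₗ[ℂ] groupVN Γ}
    (hT : IsFourierMultiplier ψ T) (c : ℂ) (g : Γ) :
    T (c • groupVN.of g) = (ψ g * c) • groupVN.of g := by
  classical
  refine groupVN_ext fun h => ?_
  rw [hT, groupFourierCoeff_smul, groupFourierCoeff_smul, groupVN.of,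
    groupFourierCoeff_leftRegular]
  split_ifs with hg
  · rw [hg]; ring
  · simp

/-- The operator matrix `x i j • λ_{(s i)⁻¹ s j}` is `x` conjugated by the diagonal unitary with
entries `λ_{s j}`, hence contractive. A multiplier acts on it by `x i j ↦ ψ((s i)⁻¹ s j) x i j`. -/
theorem isSchurBounded_of_multiplierCBNorm_le {ψ : Γ → ℂ} {C : ℝ≥0}
    (hψ : multiplierCBNorm ψ ≤ C) : IsSchurBounded ψ C := by
  intro m s x hx c
  let X : (Fin m → Fin m → ℂ) → Matrix (Fin m) (Fin m) (groupVN Γ) :=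
    fun y i j => y i j • groupVN.of ((s i)⁻¹ * s j)
  let y : Fin m → Fin m → ℂ := fun i j => ψ ((s i)⁻¹ * s j) * x i j
  have hXapp (y : Fin m → Fin m → ℂ) (v : PiLp 2 (fun _ : Fin m => GroupL2 Γ)) (i : Fin m) :
      matrixOp ((X y).map fun y => (y : GroupL2 Γ →L[ℂ] GroupL2 Γ)) v i =
        ∑ j, y i j • leftRegular ((s i)⁻¹ * s j) (v j) := by
    rw [matrixOp_apply]
    rfl
  have hX : ‖matrixOp ((X x).map fun y => (y : GroupL2 Γ →L[ℂ] GroupL2 Γ))‖ ≤ 1 := by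
    refine ContinuousLinearMap.opNorm_le_bound _ zero_le_one fun v => ?_
    rw [one_mul]
    refine le_of_sq_le_sq ?_ (norm_nonneg v)
    rw [PiLp.norm_sq_eq_of_L2, PiLp.norm_sq_eq_of_L2]
    have h1 := sum_norm_sq_smul_le hx (fun j => leftRegular (s j) (v j))
    simp only [norm_leftRegular_apply] at h1
    refine le_trans (le_of_eq (Finset.sum_congr rfl fun i _ => ?_)) h1
    rw [hXapp, ← norm_leftRegular_apply (s i)⁻¹ (∑ j, x i j • leftRegular (s j) (v j)), map_sum]
    simp only [map_smul, leftRegular_mul, mul_apply_eq_comp]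
  have hY : ‖matrixOp ((X y).map fun y => (y : GroupL2 Γ →L[ℂ] GroupL2 Γ))‖ₑ ≤
      multiplierCBNorm ψ := by
    refine le_iInf₂ fun T hT => ?_
    have h1 : ((X y).map fun y => (y : GroupL2 Γ →L[ℂ] GroupL2 Γ)) =
        (X x).map fun y => (T y : GroupL2 Γ →L[ℂ] GroupL2 Γ) := by
      ext1 i j
      exact congrArg Subtype.val (hT.map_smul_of (x i j) ((s i)⁻¹ * s j)).symm
    rw [h1]
    exact le_iSup_of_le m (le_iSup_of_le (X x) (le_iSup_of_le hX le_rfl))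
  have hY' : ‖matrixOp ((X y).map fun y => (y : GroupL2 Γ →L[ℂ] GroupL2 Γ))‖ ≤ C := by
    have := hY.trans hψ
    rw [enorm_le_coe] at this
    exact_mod_cast this
  -- With this vector every term of row `i` is a multiple of `δ_{(s i)⁻¹}`, so the scalar matrix can
  -- be read off.
  let v : PiLp 2 (fun _ : Fin m => GroupL2 Γ) :=
    WithLp.toLp 2 fun j => c j • deltaVec (s j)⁻¹
  have hdelta (g : Γ) : ‖deltaVec g‖ = 1 := by
    classical
    rw [deltaVec, lp.norm_single (by norm_num), norm_one]
  have h1 := ContinuousLinearMap.le_of_opNorm_le _ hY' v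
  have h2 := pow_le_pow_left₀ (norm_nonneg _) h1 2
  rw [mul_pow, PiLp.norm_sq_eq_of_L2, PiLp.norm_sq_eq_of_L2] at h2
  simp only [hXapp] at h2
  have h3 (i : Fin m) : ∑ j, y i j • leftRegular ((s i)⁻¹ * s j) (v j) =
      (∑ j, y i j * c j) • deltaVec (s i)⁻¹ := by
    rw [Finset.sum_smul]
    refine Finset.sum_congr rfl fun j _ => ?_
    simp only [v, map_smul, leftRegular_deltaVec, mul_inv_cancel_right, smul_smul]
  simp only [h3, norm_smul, hdelta, mul_one, v] at h2
  exact h2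

/-- The finite sections of the matrix of Fourier multiples. -/
theorem IsSchurBounded.sum_section_le {ψ : Γ → ℂ} {C : ℝ≥0} (h : IsSchurBounded ψ C) {n : ℕ}
    {x : Matrix (Fin n) (Fin n) (groupVN Γ)}
    (hx : ‖matrixOp (x.map fun y => (y : GroupL2 Γ →L[ℂ] GroupL2 Γ))‖ ≤ 1) (F : Finset Γ)
    (f : Fin n → Γ → ℂ) :
    ∑ i, ∑ k ∈ F, ‖∑ j, ∑ h ∈ F, ψ (k * h⁻¹) * groupFourierCoeff (x i j) (k * h⁻¹) * f j h‖ ^ 2 ≤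
      C ^ 2 * ∑ j, ∑ h ∈ F, ‖f j h‖ ^ 2 := by
  classical
  -- The points `k⁻¹` are repeated once for each `i : Fin n`; the scalar matrix is the compression
  -- of the operator matrix to the coordinates in `F`, hence contractive.
  have h1 := h.fintype (α := Fin n × F) (fun p => (p.2 : Γ)⁻¹)
    (fun p q => groupFourierCoeff (x p.1 q.1) (p.2 * (q.2 : Γ)⁻¹)) (fun c => ?_)
    (fun p => f p.1 p.2)
  · simp only [Fintype.sum_prod_type, inv_inv] at h1
    simp only [← Finset.sum_coe_sort F]
    exact h1
  · let v : PiLp 2 (fun _ : Fin n => GroupL2 Γ) :=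
      WithLp.toLp 2 fun j => ∑ h : F, lp.single 2 (h : Γ) (c (j, h))
    have hv : ‖v‖ ^ 2 = ∑ q, ‖c q‖ ^ 2 := by
      rw [PiLp.norm_sq_eq_of_L2, Fintype.sum_prod_type]
      refine Finset.sum_congr rfl fun j _ => ?_
      let c' : Γ → ℂ := fun h => if hh : h ∈ F then c (j, ⟨h, hh⟩) else 0
      have hc (h : F) : c (j, h) = c' h := by simp [c']
      have h2 := lp.norm_sum_single (p := 2) (E := fun _ : Γ => ℂ) (by norm_num) c' F
      simp only [v, hc]
      rw [Finset.sum_coe_sort F fun h => lp.single 2 (E := fun _ : Γ => ℂ) h (c' h),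
        Finset.sum_coe_sort F fun h => ‖c' h‖ ^ 2]
      simpa using h2
    have h2 := pow_le_pow_left₀ (norm_nonneg _) (ContinuousLinearMap.le_of_opNorm_le _ hx v) 2
    rw [one_mul, hv, PiLp.norm_sq_eq_of_L2] at h2
    refine le_trans ?_ h2
    rw [Fintype.sum_prod_type]
    refine Finset.sum_le_sum fun i _ => ?_
    rw [Finset.sum_coe_sort F fun k => ‖∑ q : Fin n × F,
      groupFourierCoeff (x i q.1) (k * (q.2 : Γ)⁻¹) * c q‖ ^ 2]
    refine le_trans (le_of_eq ?_) (GroupL2.sum_norm_sq_le _ F)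
    refine Finset.sum_congr rfl fun k _ => ?_
    rw [matrixOp_apply, lp.coeFn_sum, Finset.sum_apply, Fintype.sum_prod_type]
    congr 2
    refine Finset.sum_congr rfl fun j _ => ?_
    simp only [v, Matrix.map_apply, map_sum]
    rw [lp.coeFn_sum, Finset.sum_apply]
    refine Finset.sum_congr rfl fun h _ => ?_
    have h3 : (lp.single 2 (h : Γ) (c (j, h)) : GroupL2 Γ) = c (j, h) • deltaVec (h : Γ) := by
      rw [deltaVec, ← lp.single_smul]
      simp
    rw [h3, map_smul]
    change _ = c (j, h) * _
    rw [groupVN_coeff, mul_comm]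

/-- The multiplied matrix has bounded finite sections, so it defines an operator; being constant
along `k h⁻¹`, this operator lies in `groupVN Γ`. -/
theorem IsSchurBounded.exists_isFourierMultiplier {ψ : Γ → ℂ} {C : ℝ≥0}
    (h : IsSchurBounded ψ C) : ∃ T : groupVN Γ →ₗ[ℂ] groupVN Γ, IsFourierMultiplier ψ T := by
  have key (y : groupVN Γ) : ∃ z : groupVN Γ, ∀ g,
      groupFourierCoeff z g = ψ g * groupFourierCoeff y g := by
    -- Section bounds are available for contractions only, so `y` is scaled down; the `1 +` covers
    -- `y = 0`.
    obtain ⟨r, hr, hry⟩ : ∃ r : ℝ, 0 < r ∧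
        r * ‖(y : GroupL2 Γ →L[ℂ] GroupL2 Γ)‖ ≤ 1 := by
      refine ⟨(1 + ‖(y : GroupL2 Γ →L[ℂ] GroupL2 Γ)‖)⁻¹, by positivity, ?_⟩
      rw [inv_mul_le_iff₀ (by positivity)]
      linarith
    let Y : Matrix (Fin 1) (Fin 1) (groupVN Γ) := fun _ _ => (r : ℂ) • y
    have hx : ‖matrixOp (Y.map
        fun y => (y : GroupL2 Γ →L[ℂ] GroupL2 Γ))‖ ≤ 1 := by
      refine ContinuousLinearMap.opNorm_le_bound _ zero_le_one fun v => ?_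
      rw [one_mul]
      refine le_of_sq_le_sq ?_ (norm_nonneg v)
      rw [PiLp.norm_sq_eq_of_L2, PiLp.norm_sq_eq_of_L2]
      simp only [matrixOp_apply, Finset.univ_unique, Finset.sum_singleton, Matrix.map_apply]
      refine pow_le_pow_left₀ (norm_nonneg _) ?_ 2
      change ‖(r : ℂ) • (y : GroupL2 Γ →L[ℂ] GroupL2 Γ) (v default)‖ ≤ ‖v default‖
      rw [norm_smul, Complex.norm_real, Real.norm_eq_abs, abs_of_pos hr]
      calc _ ≤ r * (‖(y : GroupL2 Γ →L[ℂ] GroupL2 Γ)‖ * ‖v default‖) :=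
            mul_le_mul_of_nonneg_left (ContinuousLinearMap.le_opNorm _ _) hr.le
        _ ≤ 1 * ‖v default‖ := by
            rw [← mul_assoc]
            exact mul_le_mul_of_nonneg_right hry (norm_nonneg _)
        _ = _ := one_mul _
    obtain ⟨z, hz⟩ := exists_operator_of_finite_sections
      (fun k h => ψ (k * h⁻¹) * groupFourierCoeff ((r : ℂ) • y) (k * h⁻¹)) (C ^ 2)
      (fun F f => by simpa [Y] using h.sum_section_le hx F (fun _ => f))
    refine ⟨((r : ℂ)⁻¹) • ⟨z, mem_groupVN_of_coeff
      (fun g => ψ g * groupFourierCoeff ((r : ℂ) • y) g) hz⟩, fun g => ?_⟩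
    rw [groupFourierCoeff_smul, groupFourierCoeff_eq]
    simp only [hz, inv_one, mul_one, groupFourierCoeff_smul]
    have : (r : ℂ) ≠ 0 := by exact_mod_cast hr.ne'
    field_simp
  choose T hT using key
  refine ⟨{ toFun := T, map_add' := fun y z => ?_, map_smul' := fun c y => ?_ }, hT⟩
  · refine groupVN_ext fun g => ?_
    simp only [groupFourierCoeff_add, hT]
    ring
  · refine groupVN_ext fun g => ?_
    simp only [groupFourierCoeff_smul, hT, RingHom.id_apply]
    ring

theorem IsSchurBounded.multiplierCBNorm_le {ψ : Γ → ℂ} {C : ℝ≥0} (h : IsSchurBounded ψ C) :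
    multiplierCBNorm ψ ≤ C := by
  obtain ⟨T, hT⟩ := h.exists_isFourierMultiplier
  refine iInf₂_le_of_le T hT (iSup_le fun n => iSup₂_le fun x hx => ?_)
  rw [enorm_le_coe]
  suffices hs : ‖matrixOp (x.map fun y => (T y : GroupL2 Γ →L[ℂ] GroupL2 Γ))‖ ≤ C by
    exact_mod_cast hs
  refine ContinuousLinearMap.opNorm_le_bound _ C.2 fun v => ?_
  refine le_of_sq_le_sq ?_ (by positivity)
  rw [mul_pow, PiLp.norm_sq_eq_of_L2]
  -- The output is cut to `F` first, then the input to `G ⊇ F` with `G` growing, which reduces the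
  -- bound to finite sections.
  refine hasSum_le_of_sum_le (hasSum_sum fun i _ => GroupL2.hasSum_norm_sq _) fun F => ?_
  rw [Finset.sum_comm]
  have hcoeff (i : Fin n) (k : Γ) : Filter.Tendsto (fun G : Finset Γ => ∑ j, ∑ h ∈ G,
      ψ (k * h⁻¹) * groupFourierCoeff (x i j) (k * h⁻¹) * v j h) Filter.atTop
      (nhds (matrixOp (x.map fun y => (T y : GroupL2 Γ →L[ℂ] GroupL2 Γ)) v i k)) := by
    rw [matrixOp_apply, lp.coeFn_sum, Finset.sum_apply]
    refine tendsto_finsetSum _ fun j _ => ?_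
    have h1 := hasSum_apply_deltaVec (T (x i j) : GroupL2 Γ →L[ℂ] GroupL2 Γ) (v j) k
    simp only [groupVN_coeff, hT (x i j)] at h1
    simp only [mul_comm _ (v j _)]
    exact h1
  refine le_of_tendsto (tendsto_finsetSum _ fun i _ => tendsto_finsetSum _ fun k _ =>
    ((hcoeff i k).norm).pow 2) ?_
  filter_upwards [Filter.eventually_ge_atTop F] with G hG
  calc _ ≤ ∑ i, ∑ k ∈ G, ‖∑ j, ∑ h ∈ G,
        ψ (k * h⁻¹) * groupFourierCoeff (x i j) (k * h⁻¹) * v j h‖ ^ 2 :=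
        Finset.sum_le_sum fun i _ =>
          Finset.sum_le_sum_of_subset_of_nonneg hG fun _ _ _ => by positivity
    _ ≤ C ^ 2 * ∑ j, ∑ h ∈ G, ‖v j h‖ ^ 2 := h.sum_section_le hx G fun j h => v j h
    _ ≤ C ^ 2 * ‖v‖ ^ 2 := by
        rw [PiLp.norm_sq_eq_of_L2]
        exact mul_le_mul_of_nonneg_left
          (Finset.sum_le_sum fun j _ => (v j).sum_norm_sq_le G) (by positivity)

end Schur

/-! ### Free groups -/

section FreeGroup

variable {ι κ : Type*}

/-- Replace each letter `g_i^{±1}` of a word by `N i` copies of `g_{e i}^{±1}`. -/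
def dilateWord (e : ι → κ) (N : ι → ℕ) (L : List (ι × Bool)) : List (κ × Bool) :=
  (L.map fun p => List.replicate (N p.1) (e p.1, p.2)).flatten

theorem mk_replicate (a : κ) (b : Bool) (n : ℕ) :
    FreeGroup.mk (List.replicate n (a, b)) = FreeGroup.mk [(a, b)] ^ n := by
  induction n with
  | zero => rfl
  | succ n ih => rw [List.replicate_succ, pow_succ', ← ih, FreeGroup.mul_mk]; rfl

theorem lift_mk_eq_mk_dilateWord (e : ι → κ) (N : ι → ℕ) (L : List (ι × Bool)) :
    FreeGroup.lift (fun i => FreeGroup.of (e i) ^ N i) (FreeGroup.mk L) =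
      FreeGroup.mk (dilateWord e N L) := by
  induction L with
  | nil => rfl
  | cons p L ih =>
    have h1 : FreeGroup.mk (p :: L) = FreeGroup.mk [p] * FreeGroup.mk L := by
      rw [FreeGroup.mul_mk]; rfl
    have h2 : FreeGroup.mk (dilateWord e N (p :: L)) =
        FreeGroup.mk [(e p.1, p.2)] ^ N p.1 * FreeGroup.mk (dilateWord e N L) := by
      rw [← mk_replicate, FreeGroup.mul_mk]; rfl
    rw [h1, map_mul, ih, h2]
    congr 1
    obtain ⟨i, b⟩ := p
    cases b
    · simp only [FreeGroup.lift_mk, List.map_cons, List.map_nil, List.prod_singleton, cond_false]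
      rw [← inv_pow]
      rfl
    · simp only [FreeGroup.lift_mk, List.map_cons, List.map_nil, List.prod_singleton, cond_true]
      rfl

/-- Inside a block all signs agree. As no block is empty, new adjacencies occur only between blocks
of adjacent letters, where injectivity of `e` returns the condition to `L`. -/
theorem FreeGroup.IsReduced.dilateWord {e : ι → κ} (he : Function.Injective e) {N : ι → ℕ}
    (hN : ∀ i, N i ≠ 0) {L : List (ι × Bool)} (hL : FreeGroup.IsReduced L) :
    FreeGroup.IsReduced (dilateWord e N L) := by
  rw [FreeGroup.IsReduced, _root_.dilateWord, List.isChain_flatten (by simp [hN])]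
  refine ⟨?_, ?_⟩
  · simp only [List.mem_map, forall_exists_index, and_imp, forall_apply_eq_imp_iff₂]
    exact fun p _ => List.isChain_replicate_of_rel _ fun _ => rfl
  · rw [List.isChain_map]
    refine List.IsChain.imp (fun p q hpq => ?_) hL
    intro x hx y hy
    have hx' := List.eq_of_mem_replicate (List.mem_of_getLast? hx)
    have hy' := List.eq_of_mem_replicate (List.mem_of_head? hy)
    subst hx' hy'
    exact fun h => hpq (he h)

theorem norm_lift_pow [DecidableEq ι] [DecidableEq κ] {e : ι → κ} (he : Function.Injective e)
    {N : ι → ℕ} (hN : ∀ i, N i ≠ 0) (g : FreeGroup ι) :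
    (FreeGroup.lift (fun i => FreeGroup.of (e i) ^ N i) g).norm =
      (g.toWord.map fun p => N p.1).sum := by
  conv_lhs => rw [← FreeGroup.mk_toWord (x := g)]
  rw [lift_mk_eq_mk_dilateWord, FreeGroup.norm, FreeGroup.toWord_mk,
    (FreeGroup.isReduced_toWord.dilateWord he hN).reduce_eq, dilateWord, List.length_flatten]
  simp [Function.comp_def]

theorem weightedLength_nonneg [DecidableEq ι] {a : ι → ℝ} (ha : ∀ i, 0 < a i)
    (g : FreeGroup ι) : 0 ≤ weightedLength a g :=
  List.sum_nonneg <| by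
    simp only [List.mem_map, forall_exists_index, and_imp, forall_apply_eq_imp_iff₂]
    exact fun p _ => (ha p.1).le

/-- Rounding weights up to multiples of `s` gives the weighted length as `s → 0`. -/
theorem tendsto_rounded_length [DecidableEq ι] (a : ι → ℝ) (ha : ∀ i, 0 < a i) {t : ℝ}
    (ht : 0 < t) (g : FreeGroup ι) :
    Filter.Tendsto (fun s : ℝ => s * ((g.toWord.map fun p => ⌈t * a p.1 / s⌉₊).sum : ℕ))
      (nhdsWithin 0 (Set.Ioi 0)) (nhds (t * weightedLength a g)) := by
  rw [weightedLength]
  generalize g.toWord = L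
  induction L with
  | nil => simp
  | cons p L ih =>
    simp only [List.map_cons, List.sum_cons, Nat.cast_add, mul_add]
    refine Filter.Tendsto.add ?_ ih
    have hp : 0 ≤ t * a p.1 := (mul_pos ht (ha p.1)).le
    have hid : Filter.Tendsto (fun s : ℝ => t * a p.1 + s) (nhdsWithin 0 (Set.Ioi 0))
        (nhds (t * a p.1)) := by
      have : Filter.Tendsto (fun s : ℝ => t * a p.1 + s) (nhds 0) (nhds (t * a p.1 + 0)) :=
        tendsto_const_nhds.add Filter.tendsto_id
      rw [add_zero] at this
      exact this.mono_left nhdsWithin_le_nhds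
    -- Squeeze: `t a ≤ s ⌈t a / s⌉ ≤ t a + s`.
    refine tendsto_of_tendsto_of_tendsto_of_le_of_le' tendsto_const_nhds hid ?_ ?_
    · filter_upwards [self_mem_nhdsWithin] with s hs
      rw [← div_le_iff₀' hs]
      exact Nat.le_ceil _
    · filter_upwards [self_mem_nhdsWithin] with s (hs : 0 < s)
      have h1 := (Nat.ceil_lt_add_one (div_nonneg hp hs.le)).le
      calc _ ≤ s * (t * a p.1 / s + 1) := mul_le_mul_of_nonneg_left h1 hs.le
        _ = _ := by field_simp

end FreeGroup

theorem proposition2p5 (φ : ℝ → ℂ) (hφ : ContinuousOn φ (Set.Ici 0)) (C : ℝ≥0)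
    (hC : ∀ t : ℝ, 0 < t → t < 1 →
      multiplierCBNorm (fun g : FreeGroup ℕ => φ (t * (g.norm : ℝ))) ≤ C) :
    ∀ (ι : Type) [Countable ι] [DecidableEq ι] (a : ι → ℝ), (∀ i, 0 < a i) →
      ∀ t : ℝ, 0 < t →
        multiplierCBNorm (fun g : FreeGroup ι => φ (t * weightedLength a g)) ≤ C := by
  intro ι _ _ a ha t ht
  obtain ⟨e, he⟩ := exists_injective_nat ι
  refine IsSchurBounded.multiplierCBNorm_le ?_
  refine IsSchurBounded.of_tendsto (l := nhdsWithin (0 : ℝ) (Set.Ioi 0))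
    (ψ := fun s g => φ (s * ((g.toWord.map fun p => ⌈t * a p.1 / s⌉₊).sum : ℕ))) ?_ fun g => ?_
  · filter_upwards [Ioo_mem_nhdsGT (zero_lt_one (α := ℝ))] with s hs
    have hN (i : ι) : ⌈t * a i / s⌉₊ ≠ 0 :=
      (Nat.ceil_pos.2 (div_pos (mul_pos ht (ha i)) hs.1)).ne'
    have h := (isSchurBounded_of_multiplierCBNorm_le (hC s hs.1 hs.2)).comp_monoidHom
      (FreeGroup.lift fun i => FreeGroup.of (e i) ^ ⌈t * a i / s⌉₊)
    simpa only [norm_lift_pow he hN] using h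
  · have h0 : t * weightedLength a g ∈ Set.Ici (0 : ℝ) :=
      mul_nonneg ht.le (weightedLength_nonneg ha g)
    -- Continuity holds only within `[0, ∞)`, so the rounded lengths must be seen to stay there.
    refine (hφ _ h0).tendsto.comp (tendsto_nhdsWithin_iff.2
      ⟨tendsto_rounded_length a ha ht g, ?_⟩)
    filter_upwards [self_mem_nhdsWithin] with s (hs : 0 < s)
    exact mul_nonneg hs.le (Nat.cast_nonneg _)
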